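/- Let $n$ be a non-negative integer and let $r^1,\ldots,r^n\in\mathbb{Z}^n$ satisfy $1\le|\det(r^1,\ldots,r^n)|\le 5$. Let $C=\operatorname{pos}\{r^1,\ldots,r^n\}\subseteq\mathbb{R}^n$ be the simplicial cone of all non-negative real combinations of $r^1,\ldots,r^n$, and let $\mathcal{H}(C)$ be its Hilbert basis, i.e. the smallest set of vectors in $C\cap\mathbb{Z}^n$ such that every element of $C\cap\mathbb{Z}^n$ is a non-negative integral combination of elements of the set. Then the integer Carath\'eodory rank $$\operatorname{ICR}(C)=\max_{z\in C\cap\mathbb{Z}^n}\ \min\Bigl\{k\in\mathbb{Z}_{\ge 0} : z=\sum_{i=1}^k\lambda_i h^i \text{ with } \lambda_i\in\mathbb{Z}_{\ge 0},\ h^i\in\mathcal{H}(C)\text{ for } i=1,\ldots,k\Bigr\}$$ equals $n$; that is, $C$ has the integral Carath\'eodory property. -/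

import Mathlib

namespace IntCarath

/-- The integral vectors contained in a cone `C ⊆ ℝⁿ`, i.e. `C ∩ ℤⁿ`. -/
def intPoints {n : ℕ} (C : PointedCone ℝ (Fin n → ℝ)) : Set (Fin n → ℤ) :=
  {z | (fun i => (z i : ℝ)) ∈ C}

/-- `H` is a set of integral vectors in `C` such that every element of `C ∩ ℤⁿ` is a
non-negative integral combination of elements of `H`. -/
def Generates {n : ℕ} (C : PointedCone ℝ (Fin n → ℝ)) (H : Set (Fin n → ℤ)) : Prop :=
  H ⊆ intPoints C ∧ ∀ z ∈ intPoints C, z ∈ AddSubmonoid.closure H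

/-- The Hilbert basis of `C`: the smallest generating set of `C ∩ ℤⁿ`, given as the intersection
of all generating sets. -/
def hilbertBasis {n : ℕ} (C : PointedCone ℝ (Fin n → ℝ)) : Set (Fin n → ℤ) :=
  ⋂₀ {H | Generates C H}

/-- `z = ∑_{i=1}^k λᵢ hⁱ` with `λᵢ ∈ ℕ` and `hⁱ` in the Hilbert basis of `C`. -/
def IsCombinationOf {n : ℕ} (C : PointedCone ℝ (Fin n → ℝ)) (z : Fin n → ℤ) (k : ℕ) : Prop :=
  ∃ (c : Fin k → ℕ) (h : Fin k → (Fin n → ℤ)),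
    (∀ i, h i ∈ hilbertBasis C) ∧ z = ∑ i, c i • h i

/-- The integer Carathéodory rank of `C`: the maximum over `z ∈ C ∩ ℤⁿ` of the minimal number of
Hilbert basis elements needed to write `z` as a non-negative integral combination. It takes values
in `ℕ∞`: it is `⊤` if some `z` has no such representation or if the numbers needed are unbounded.
A finite value is attained, as a supremum in `ℕ∞` over a nonempty set. -/
noncomputable def icr {n : ℕ} (C : PointedCone ℝ (Fin n → ℝ)) : ℕ∞ :=
  ⨆ z ∈ intPoints C, ⨅ k ∈ {k : ℕ | IsCombinationOf C z k}, (k : ℕ∞)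

/-- `pos {r¹, …, rᵏ} ⊆ ℝⁿ`: all finite non-negative real combinations of integral vectors `rʲ`. -/
noncomputable def pos {n k : ℕ} (r : Fin k → (Fin n → ℤ)) : PointedCone ℝ (Fin n → ℝ) :=
  PointedCone.hull ℝ (Set.range fun j : Fin k => fun i : Fin n => (r j i : ℝ))

/-- If the cone has a Hilbert basis, i.e. a least generating set of its integral vectors, then
`hilbertBasis` is that set. -/
theorem hilbertBasis_eq_of_isLeast {n : ℕ} {C : PointedCone ℝ (Fin n → ℝ)}
    {H : Set (Fin n → ℤ)} (hH : IsLeast {H | Generates C H} H) : hilbertBasis C = H :=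
  Set.Subset.antisymm (Set.sInter_subset_of_mem hH.1) (Set.subset_sInter fun _ h => hH.2 h)

end IntCarath

/-! Upper bound. Suppose first that every `r j` lies in the Hilbert basis. The group `G = ℤⁿ / ⟨r⟩`
has order `|det| ≤ 5`, so it is cyclic or the Klein four-group. Let `d` be `|det|` in the cyclic
case and `2` in the Klein case. Scaled by `d` and reduced mod `d`, each coordinate with respect to
`r` is a character of `G`. This character is the type of the coordinate, and a table `b` lists the
values of all characters on all elements.

For `z` in the cone, keep only the least coordinate of each type. By `Covers`, this vector of minima
is a combination of irreducible box vectors plus non-negative multiples of `d` on single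
coordinates, with at most one summand charged to each type. For each set of types this is shown by
an explicit subdivision of the orthant into cones, up to symmetries of the table. In
`HasTable.isCombinationOf` the result is lifted to `ℤⁿ`: where a box vector is charged to a type,
the remainder at its least coordinate `j` is zero, so the box vector takes the place of `r j`; every
other `r j` absorbs its own remainder. This makes `n` summands.

If some `r j` is not in the Hilbert basis, it splits as `u + v` along its own ray. Replacing `r j`
by `u` keeps the cone and lowers `|det|`, so strong induction applies.

Lower bound. The Hilbert basis is finite. If every point needed fewer than `n` elements, infinitely
many points `∑ N ^ j • r j` of the moment curve would use the same set of fewer than `n` elements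
and lie in a proper subspace. By Vandermonde, any `n` of them are independent. -/

namespace IntCarath

/-! ### Decompositions over a table of residues, and their symmetries. -/

section Tables

variable {K T : Type*}

/-- `k` labels an indecomposable vector of the family `b`, restricted to the coordinates in `S`. -/
def IsAtom (b : K → T → ℤ) (S : Finset T) (k : K) : Prop :=
  (∃ s ∈ S, b k s ≠ 0) ∧ ∀ k₁ k₂, (∀ s ∈ S, b k₁ s + b k₂ s = b k s) →
    (∀ s ∈ S, b k₁ s = 0) ∨ ∀ s ∈ S, b k₂ s = 0

instance [Fintype K] [DecidableEq T] (b : K → T → ℤ) (S : Finset T) :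
    DecidablePred (IsAtom b S) :=
  fun _ => by unfold IsAtom; infer_instance

theorem IsAtom.map {b : K → T → ℤ} {S : Finset T} {k : K} (h : IsAtom b S k) (e : K ≃ K)
    (f : T ≃ T) (hb : ∀ k s, b (e k) (f s) = b k s) : IsAtom b (S.map f.toEmbedding) (e k) := by
  obtain ⟨⟨s, hs, hne⟩, h⟩ := h
  have hb' : ∀ k s, b k (f s) = b (e.symm k) s := fun k s => by
    rw [← hb (e.symm k), e.apply_symm_apply]
  refine ⟨⟨f s, by simpa using hs, by rwa [hb]⟩, fun k₁ k₂ h' => ?_⟩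
  simp only [Finset.forall_mem_map, Equiv.coe_toEmbedding, hb', e.symm_apply_apply] at h' ⊢
  exact h _ _ h'

variable [Fintype T]

/-- On the coordinates in `S`, the vector `y` is a combination of atoms of `b` and of multiples of
`d` times unit vectors, with at most one summand for each coordinate: the atom `b (τ s)` can only
be used if the unit vector at `s` is not. -/
def Decomposes (d : ℤ) (b : K → T → ℤ) (S : Finset T) (y : T → ℤ) : Prop :=
  ∃ (τ : T → K) (c : T → ℤ), ∀ s, 0 ≤ c s ∧
    (c s ≠ 0 → s ∈ S ∧ IsAtom b S (τ s) ∧ ∑ t, c t * b (τ t) s = y s) ∧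
    (s ∈ S → ∑ t, c t * b (τ t) s ≤ y s ∧ d ∣ y s - ∑ t, c t * b (τ t) s)

/-- Every non-negative vector congruent to a member of `b` modulo `d` decomposes. -/
def Covers (d : ℤ) (b : K → T → ℤ) (S : Finset T) : Prop :=
  ∀ k y, (∀ s ∈ S, 0 ≤ y s ∧ d ∣ y s - b k s) → Decomposes d b S y

theorem Decomposes.map {d : ℤ} {b : K → T → ℤ} {S : Finset T} (e : K ≃ K) (f : T ≃ T)
    (hb : ∀ k s, b (e k) (f s) = b k s) {y : T → ℤ} (h : Decomposes d b S (y ∘ f)) :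
    Decomposes d b (S.map f.toEmbedding) y := by
  obtain ⟨τ, c, h⟩ := h
  have hsum : ∀ s, ∑ t, c (f.symm t) * b (e (τ (f.symm t))) (f s) = ∑ t, c t * b (τ t) s := by
    intro s
    rw [← f.sum_comp]
    simp [hb]
  refine ⟨fun t => e (τ (f.symm t)), fun t => c (f.symm t), fun s => ?_⟩
  obtain ⟨s, rfl⟩ := f.surjective s
  simp only [hsum, f.symm_apply_apply]
  obtain ⟨h₁, h₂, h₃⟩ := h s
  refine ⟨h₁, fun hc => ?_, fun hs => h₃ (by simpa using hs)⟩
  exact ⟨by simpa using (h₂ hc).1, (h₂ hc).2.1.map e f hb, (h₂ hc).2.2⟩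

theorem Covers.map {d : ℤ} {b : K → T → ℤ} {S : Finset T} (h : Covers d b S) (e : K ≃ K)
    (f : T ≃ T) (hb : ∀ k s, b (e k) (f s) = b k s) : Covers d b (S.map f.toEmbedding) :=
  fun k y hy => Decomposes.map e f hb <| h (e.symm k) (y ∘ f) fun s hs => by
    rw [← hb, e.apply_symm_apply]
    exact hy (f s) (by simpa using hs)

theorem covers_empty [Inhabited K] (d : ℤ) (b : K → T → ℤ) : Covers d b ∅ :=
  fun _ _ _ => ⟨fun _ => default, 0, fun _ => by simp⟩

/-- Coordinates on which all vectors of `b` vanish are irrelevant. -/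
theorem Covers.insert_coord [DecidableEq T] {d : ℤ} {b : K → T → ℤ} {S : Finset T} (h : Covers d b S)
    {s₀ : T} (h₀ : ∀ k, b k s₀ = 0) : Covers d b (insert s₀ S) := by
  have hat : ∀ k, IsAtom b S k → IsAtom b (insert s₀ S) k := by
    simp only [IsAtom, Finset.forall_mem_insert, Finset.exists_mem_insert, h₀]
    simp
  intro k y hy
  obtain ⟨τ, c, hc⟩ := h k y fun s hs => hy s (Finset.mem_insert_of_mem hs)
  refine ⟨τ, c, fun s => ⟨(hc s).1, fun hs => ?_, fun hs => ?_⟩⟩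
  · obtain ⟨h₁, h₂, h₃⟩ := (hc s).2.1 hs
    exact ⟨Finset.mem_insert_of_mem h₁, hat _ h₂, h₃⟩
  · rcases Finset.mem_insert.1 hs with rfl | hs
    · have := hy s (Finset.mem_insert_self _ _)
      simpa [h₀] using this
    · exact (hc s).2.2 hs

/-- Separates the atom test, settled by `decide` once for a finite set `A`, from the linear
arithmetic left to `omega`. -/
theorem decomposes_of_atoms {d : ℤ} {b : K → T → ℤ} {S : Finset T} {y : T → ℤ} {A : Finset K}
    (hA : ∀ k ∈ A, IsAtom b S k) (τ : T → K) (c : T → ℤ) (h : ∀ s, 0 ≤ c s ∧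
      (c s ≠ 0 → s ∈ S ∧ τ s ∈ A ∧ ∑ t, c t * b (τ t) s = y s) ∧
      (s ∈ S → ∑ t, c t * b (τ t) s ≤ y s ∧ d ∣ y s - ∑ t, c t * b (τ t) s)) :
    Decomposes d b S y :=
  ⟨τ, c, fun s => ⟨(h s).1, fun hs => ⟨((h s).2.1 hs).1, hA _ ((h s).2.1 hs).2.1,
    ((h s).2.1 hs).2.2⟩, (h s).2.2⟩⟩

end Tables

/-! ### Explicit decompositions for cyclic groups of order at most five. -/

/-- The multiplication table of the integers modulo `d`. -/
def cyclicTable (d : ℕ) (k s : Fin d) : ℤ := ((k.val * s.val % d : ℕ) : ℤ)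

/-- Linear parameters `t` and `w` make the multiplicities found by solving for `y` integral
expressions, with no division by `d`. -/
theorem exists_cyclic_param {d : ℕ} {S : Finset (Fin d)} {k : Fin d} {y : Fin d → ℤ}
    (h : ∀ s ∈ S, 0 ≤ y s ∧ (d : ℤ) ∣ y s - cyclicTable d k s) :
    ∃ (t : ℤ) (w : Fin d → ℤ), ∀ s ∈ S, 0 ≤ y s ∧ y s = s.val * t + d * w s := by
  refine ⟨k.val, fun s => (y s - s.val * k.val) / d, fun s hs => ⟨(h s hs).1, ?_⟩⟩
  have h₁ : (d : ℤ) ∣ y s - s.val * k.val := by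
    have h₂ : (d : ℤ) ∣ cyclicTable d k s - s.val * k.val := by
      rw [cyclicTable, mul_comm (s.val : ℤ), Int.natCast_mod, Nat.cast_mul, ← dvd_neg, neg_sub]
      exact Int.dvd_self_sub_emod
    simpa using dvd_add (h s hs).2 h₂
  rw [Int.mul_ediv_cancel' h₁]
  ring

theorem forall_fin_three {p : Fin 3 → Prop} : (∀ i, p i) ↔ p 0 ∧ p 1 ∧ p 2 := by
  simp [Fin.forall_fin_succ]

theorem forall_fin_four {p : Fin 4 → Prop} : (∀ i, p i) ↔ p 0 ∧ p 1 ∧ p 2 ∧ p 3 := by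
  simp [Fin.forall_fin_succ]

theorem forall_fin_five {p : Fin 5 → Prop} : (∀ i, p i) ↔ p 0 ∧ p 1 ∧ p 2 ∧ p 3 ∧ p 4 := by
  simp [Fin.forall_fin_succ]

theorem covers_cyclic_two_one : Covers 2 (cyclicTable 2) {1} := by
  intro k y hy
  have hA : ∀ k ∈ ({1} : Finset (Fin 2)), IsAtom (cyclicTable 2) {1} k := by decide
  obtain ⟨t, w, h⟩ := exists_cyclic_param hy
  simp only [Finset.mem_singleton, forall_eq, Fin.isValue] at h
  obtain ⟨p1, e1⟩ := h
  norm_num at e1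
  exact decomposes_of_atoms hA ![0, 1] ![0, t + 2 * w 1] (by
        simp [Fin.forall_fin_two, Fin.sum_univ_two, cyclicTable]; omega)

theorem covers_cyclic_three_one : Covers 3 (cyclicTable 3) {1} := by
  intro k y hy
  have hA : ∀ k ∈ ({1} : Finset (Fin 3)), IsAtom (cyclicTable 3) {1} k := by decide
  obtain ⟨t, w, h⟩ := exists_cyclic_param hy
  simp only [Finset.mem_singleton, forall_eq, Fin.isValue] at h
  obtain ⟨p1, e1⟩ := h
  norm_num at e1
  exact decomposes_of_atoms hA ![0, 1, 0] ![0, t + 3 * w 1, 0] (by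
        simp [forall_fin_three, Fin.sum_univ_three, cyclicTable]; omega)

theorem covers_cyclic_three_one_two : Covers 3 (cyclicTable 3) {1, 2} := by
  intro k y hy
  have hA : ∀ k ∈ ({1, 2} : Finset (Fin 3)), IsAtom (cyclicTable 3) {1, 2} k := by decide
  obtain ⟨t, w, h⟩ := exists_cyclic_param hy
  simp only [Finset.forall_mem_insert, Finset.mem_singleton, forall_eq, Fin.isValue] at h
  obtain ⟨⟨p1, e1⟩, ⟨p2, e2⟩⟩ := h
  norm_num at e1 e2
  -- The atoms are `(1, 2)` and `(2, 1)`. Solving `y = c₁ (1, 2) + c₂ (2, 1)` gives `c₁ = (2 y₂ -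
  -- y₁) / 3` and `c₂ = (2 y₁ - y₂) / 3`. If one of them is not positive, the other atom alone is
  -- used and a multiple of 3 remains on one coordinate. The later case splits likewise locate `y`
  -- in a cone of a subdivision. Entries of `τ` with multiplicity 0 are placeholders.
  by_cases h : 0 ≤ y 1 - 2 * y 2
  · exact decomposes_of_atoms hA ![0, 0, 2] ![0, 0, 2 * t + 3 * w 2] (by
        simp [forall_fin_three, Fin.sum_univ_three, cyclicTable]; omega)
  · by_cases h : 0 ≤ -2 * y 1 + y 2
    · exact decomposes_of_atoms hA ![0, 1, 0] ![0, t + 3 * w 1, 0] (by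
        simp [forall_fin_three, Fin.sum_univ_three, cyclicTable]; omega)
    · exact decomposes_of_atoms hA ![0, 1, 2] ![0, t - w 1 + 2 * w 2, 2 * w 1 - w 2] (by
        simp [forall_fin_three, Fin.sum_univ_three, cyclicTable]; omega)

theorem covers_cyclic_four_one : Covers 4 (cyclicTable 4) {1} := by
  intro k y hy
  have hA : ∀ k ∈ ({1} : Finset (Fin 4)), IsAtom (cyclicTable 4) {1} k := by decide
  obtain ⟨t, w, h⟩ := exists_cyclic_param hy
  simp only [Finset.mem_singleton, forall_eq, Fin.isValue] at h
  obtain ⟨p1, e1⟩ := h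
  norm_num at e1
  exact decomposes_of_atoms hA ![0, 1, 0, 0] ![0, t + 4 * w 1, 0, 0] (by
        simp [forall_fin_four, Fin.sum_univ_four, cyclicTable]; omega)

theorem covers_cyclic_four_two : Covers 4 (cyclicTable 4) {2} := by
  intro k y hy
  have hA : ∀ k ∈ ({1} : Finset (Fin 4)), IsAtom (cyclicTable 4) {2} k := by decide
  obtain ⟨t, w, h⟩ := exists_cyclic_param hy
  simp only [Finset.mem_singleton, forall_eq, Fin.isValue] at h
  obtain ⟨p2, e2⟩ := h
  norm_num at e2
  exact decomposes_of_atoms hA ![0, 0, 1, 0] ![0, 0, t + 2 * w 2, 0] (by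
        simp [forall_fin_four, Fin.sum_univ_four, cyclicTable]; omega)

theorem covers_cyclic_four_one_two : Covers 4 (cyclicTable 4) {1, 2} := by
  intro k y hy
  have hA : ∀ k ∈ ({1, 2} : Finset (Fin 4)), IsAtom (cyclicTable 4) {1, 2} k := by decide
  obtain ⟨t, w, h⟩ := exists_cyclic_param hy
  simp only [Finset.forall_mem_insert, Finset.mem_singleton, forall_eq, Fin.isValue] at h
  obtain ⟨⟨p1, e1⟩, ⟨p2, e2⟩⟩ := h
  norm_num at e1 e2
  by_cases h : 0 ≤ -2 * y 1 + y 2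
  · exact decomposes_of_atoms hA ![0, 1, 0, 0] ![0, t + 4 * w 1, 0, 0] (by
        simp [forall_fin_four, Fin.sum_univ_four, cyclicTable]; omega)
  · exact decomposes_of_atoms hA ![0, 1, 2, 0] ![0, t + 2 * w 2, 2 * w 1 - w 2, 0] (by
        simp [forall_fin_four, Fin.sum_univ_four, cyclicTable]; omega)

theorem covers_cyclic_four_one_three : Covers 4 (cyclicTable 4) {1, 3} := by
  intro k y hy
  have hA : ∀ k ∈ ({1, 2, 3} : Finset (Fin 4)), IsAtom (cyclicTable 4) {1, 3} k := by decide
  obtain ⟨t, w, h⟩ := exists_cyclic_param hy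
  simp only [Finset.forall_mem_insert, Finset.mem_singleton, forall_eq, Fin.isValue] at h
  obtain ⟨⟨p1, e1⟩, ⟨p3, e3⟩⟩ := h
  norm_num at e1 e3
  by_cases h : 0 ≤ -y 1 + y 3
  · by_cases h : 0 ≤ -3 * y 1 + y 3
    · exact decomposes_of_atoms hA ![0, 1, 0, 0] ![0, t + 4 * w 1, 0, 0] (by
        simp [forall_fin_four, Fin.sum_univ_four, cyclicTable]; omega)
    · exact decomposes_of_atoms hA ![0, 1, 0, 2] ![0, t - 2 * w 1 + 2 * w 3, 0, 3 * w 1 - w 3] (by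
        simp [forall_fin_four, Fin.sum_univ_four, cyclicTable]; omega)
  · by_cases h : 0 ≤ y 1 - 3 * y 3
    · exact decomposes_of_atoms hA ![0, 0, 0, 3] ![0, 0, 0, 3 * t + 4 * w 3] (by
        simp [forall_fin_four, Fin.sum_univ_four, cyclicTable]; omega)
    · exact decomposes_of_atoms hA ![0, 2, 0, 3]
        ![0, 2 * t - w 1 + 3 * w 3, 0, -t + 2 * w 1 - 2 * w 3] (by
        simp [forall_fin_four, Fin.sum_univ_four, cyclicTable]; omega)

theorem covers_cyclic_four_one_two_three : Covers 4 (cyclicTable 4) {1, 2, 3} := by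
  intro k y hy
  have hA : ∀ k ∈ ({1, 2, 3} : Finset (Fin 4)), IsAtom (cyclicTable 4) {1, 2, 3} k := by decide
  obtain ⟨t, w, h⟩ := exists_cyclic_param hy
  simp only [Finset.forall_mem_insert, Finset.mem_singleton, forall_eq, Fin.isValue] at h
  obtain ⟨⟨p1, e1⟩, ⟨p2, e2⟩, ⟨p3, e3⟩⟩ := h
  norm_num at e1 e2 e3
  by_cases h : 0 ≤ -y 1 + y 3
  · by_cases h : 0 ≤ -2 * y 1 + y 2
    · by_cases h : 0 ≤ -3 * y 1 + y 3
      · exact decomposes_of_atoms hA ![0, 1, 0, 0] ![0, t + 4 * w 1, 0, 0] (by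
        simp [forall_fin_four, Fin.sum_univ_four, cyclicTable]; omega)
      · exact decomposes_of_atoms hA ![0, 1, 0, 2] ![0, t - 2 * w 1 + 2 * w 3, 0, 3 * w 1 - w 3] (by
        simp [forall_fin_four, Fin.sum_univ_four, cyclicTable]; omega)
    · by_cases h : 0 ≤ -y 1 - y 2 + y 3
      · exact decomposes_of_atoms hA ![0, 1, 2, 0] ![0, t + 2 * w 2, 2 * w 1 - w 2, 0] (by
        simp [forall_fin_four, Fin.sum_univ_four, cyclicTable]; omega)
      · exact decomposes_of_atoms hA ![0, 1, 0, 2] ![0, t - 2 * w 1 + 2 * w 3, 0, 3 * w 1 - w 3] (by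
        simp [forall_fin_four, Fin.sum_univ_four, cyclicTable]; omega)
  · by_cases h : 0 ≤ y 2 - 2 * y 3
    · by_cases h : 0 ≤ y 1 - 3 * y 3
      · exact decomposes_of_atoms hA ![0, 0, 0, 3] ![0, 0, 0, 3 * t + 4 * w 3] (by
        simp [forall_fin_four, Fin.sum_univ_four, cyclicTable]; omega)
      · exact decomposes_of_atoms hA ![0, 2, 0, 3]
          ![0, 2 * t - w 1 + 3 * w 3, 0, -t + 2 * w 1 - 2 * w 3] (by
        simp [forall_fin_four, Fin.sum_univ_four, cyclicTable]; omega)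
    · by_cases h : 0 ≤ -y 1 + y 2 + y 3
      · exact decomposes_of_atoms hA ![0, 2, 0, 3]
          ![0, 2 * t - w 1 + 3 * w 3, 0, -t + 2 * w 1 - 2 * w 3] (by
        simp [forall_fin_four, Fin.sum_univ_four, cyclicTable]; omega)
      · exact decomposes_of_atoms hA ![0, 0, 2, 3] ![0, 0, t - w 2 + 2 * w 3, t + 2 * w 2] (by
        simp [forall_fin_four, Fin.sum_univ_four, cyclicTable]; omega)

theorem covers_cyclic_five_one : Covers 5 (cyclicTable 5) {1} := by
  intro k y hy
  have hA : ∀ k ∈ ({1} : Finset (Fin 5)), IsAtom (cyclicTable 5) {1} k := by decide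
  obtain ⟨t, w, h⟩ := exists_cyclic_param hy
  simp only [Finset.mem_singleton, forall_eq, Fin.isValue] at h
  obtain ⟨p1, e1⟩ := h
  norm_num at e1
  exact decomposes_of_atoms hA ![0, 1, 0, 0, 0] ![0, t + 5 * w 1, 0, 0, 0] (by
        simp [forall_fin_five, Fin.sum_univ_five, cyclicTable]; omega)

theorem covers_cyclic_five_one_two : Covers 5 (cyclicTable 5) {1, 2} := by
  intro k y hy
  have hA : ∀ k ∈ ({1, 3} : Finset (Fin 5)), IsAtom (cyclicTable 5) {1, 2} k := by decide
  obtain ⟨t, w, h⟩ := exists_cyclic_param hy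
  simp only [Finset.forall_mem_insert, Finset.mem_singleton, forall_eq, Fin.isValue] at h
  obtain ⟨⟨p1, e1⟩, ⟨p2, e2⟩⟩ := h
  norm_num at e1 e2
  by_cases h : 0 ≤ -2 * y 1 + y 2
  · exact decomposes_of_atoms hA ![0, 1, 0, 0, 0] ![0, t + 5 * w 1, 0, 0, 0] (by
        simp [forall_fin_five, Fin.sum_univ_five, cyclicTable]; omega)
  · by_cases h : 0 ≤ y 1 - 3 * y 2
    · exact decomposes_of_atoms hA ![0, 0, 3, 0, 0] ![0, 0, 2 * t + 5 * w 2, 0, 0] (by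
        simp [forall_fin_five, Fin.sum_univ_five, cyclicTable]; omega)
    · exact decomposes_of_atoms hA ![0, 1, 3, 0, 0] ![0, t - w 1 + 3 * w 2, 2 * w 1 - w 2, 0, 0] (by
        simp [forall_fin_five, Fin.sum_univ_five, cyclicTable]; omega)

theorem covers_cyclic_five_one_four : Covers 5 (cyclicTable 5) {1, 4} := by
  intro k y hy
  have hA : ∀ k ∈ ({1, 2, 3, 4} : Finset (Fin 5)), IsAtom (cyclicTable 5) {1, 4} k := by decide
  obtain ⟨t, w, h⟩ := exists_cyclic_param hy
  simp only [Finset.forall_mem_insert, Finset.mem_singleton, forall_eq, Fin.isValue] at h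
  obtain ⟨⟨p1, e1⟩, ⟨p4, e4⟩⟩ := h
  norm_num at e1 e4
  by_cases h : 0 ≤ -2 * y 1 + 3 * y 4
  · by_cases h : 0 ≤ -3 * y 1 + 2 * y 4
    · by_cases h : 0 ≤ -4 * y 1 + y 4
      · exact decomposes_of_atoms hA ![0, 1, 0, 0, 0] ![0, t + 5 * w 1, 0, 0, 0] (by
        simp [forall_fin_five, Fin.sum_univ_five, cyclicTable]; omega)
      · exact decomposes_of_atoms hA ![0, 1, 0, 0, 2]
          ![0, t - 3 * w 1 + 2 * w 4, 0, 0, 4 * w 1 - w 4] (by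
        simp [forall_fin_five, Fin.sum_univ_five, cyclicTable]; omega)
    · exact decomposes_of_atoms hA ![0, 2, 0, 0, 3]
        ![0, 2 * t - 2 * w 1 + 3 * w 4, 0, 0, -t + 3 * w 1 - 2 * w 4] (by
        simp [forall_fin_five, Fin.sum_univ_five, cyclicTable]; omega)
  · by_cases h : 0 ≤ y 1 - 4 * y 4
    · exact decomposes_of_atoms hA ![0, 0, 0, 0, 4] ![0, 0, 0, 0, 4 * t + 5 * w 4] (by
        simp [forall_fin_five, Fin.sum_univ_five, cyclicTable]; omega)
    · exact decomposes_of_atoms hA ![0, 3, 0, 0, 4]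
        ![0, 3 * t - w 1 + 4 * w 4, 0, 0, -2 * t + 2 * w 1 - 3 * w 4] (by
        simp [forall_fin_five, Fin.sum_univ_five, cyclicTable]; omega)

theorem covers_cyclic_five_one_two_three : Covers 5 (cyclicTable 5) {1, 2, 3} := by
  intro k y hy
  have hA : ∀ k ∈ ({1, 2, 3, 4} : Finset (Fin 5)), IsAtom (cyclicTable 5) {1, 2, 3} k := by decide
  obtain ⟨t, w, h⟩ := exists_cyclic_param hy
  simp only [Finset.forall_mem_insert, Finset.mem_singleton, forall_eq, Fin.isValue] at h
  obtain ⟨⟨p1, e1⟩, ⟨p2, e2⟩, ⟨p3, e3⟩⟩ := h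
  norm_num at e1 e2 e3
  by_cases h : 0 ≤ -3 * y 2 + 2 * y 3
  · by_cases h : 0 ≤ -2 * y 1 + y 2
    · exact decomposes_of_atoms hA ![0, 1, 0, 0, 0] ![0, t + 5 * w 1, 0, 0, 0] (by
        simp [forall_fin_five, Fin.sum_univ_five, cyclicTable]; omega)
    · by_cases h : 0 ≤ y 1 - 3 * y 2
      · by_cases h : 0 ≤ -4 * y 2 + y 3
        · exact decomposes_of_atoms hA ![0, 0, 3, 0, 0] ![0, 0, 2 * t + 5 * w 2, 0, 0] (by
        simp [forall_fin_five, Fin.sum_univ_five, cyclicTable]; omega)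
        · exact decomposes_of_atoms hA ![0, 0, 1, 3, 0]
            ![0, 0, t + 4 * w 2 - w 3, -3 * w 2 + 2 * w 3, 0] (by
        simp [forall_fin_five, Fin.sum_univ_five, cyclicTable]; omega)
      · by_cases h : 0 ≤ -y 1 - y 2 + y 3
        · exact decomposes_of_atoms hA ![0, 1, 3, 0, 0]
            ![0, t - w 1 + 3 * w 2, 2 * w 1 - w 2, 0, 0] (by
        simp [forall_fin_five, Fin.sum_univ_five, cyclicTable]; omega)
        · exact decomposes_of_atoms hA ![0, 0, 1, 3, 0]
            ![0, 0, t + 4 * w 2 - w 3, -3 * w 2 + 2 * w 3, 0] (by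
        simp [forall_fin_five, Fin.sum_univ_five, cyclicTable]; omega)
  · by_cases h : 0 ≤ -3 * y 1 + y 3
    · exact decomposes_of_atoms hA ![0, 1, 0, 0, 0] ![0, t + 5 * w 1, 0, 0, 0] (by
        simp [forall_fin_five, Fin.sum_univ_five, cyclicTable]; omega)
    · by_cases h : 0 ≤ y 1 - 2 * y 3
      · by_cases h : 0 ≤ y 2 - 4 * y 3
        · exact decomposes_of_atoms hA ![0, 0, 0, 2, 0] ![0, 0, 0, 3 * t + 5 * w 3, 0] (by
        simp [forall_fin_five, Fin.sum_univ_five, cyclicTable]; omega)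
        · by_cases h : 0 ≤ -2 * y 2 + 3 * y 3
          · exact decomposes_of_atoms hA ![0, 0, 1, 4, 0]
              ![0, 0, t - 2 * w 2 + 3 * w 3, 3 * w 2 - 2 * w 3, 0] (by
        simp [forall_fin_five, Fin.sum_univ_five, cyclicTable]; omega)
          · exact decomposes_of_atoms hA ![0, 0, 2, 4, 0]
              ![0, 0, -t + 2 * w 2 - 3 * w 3, 2 * t - w 2 + 4 * w 3, 0] (by
        simp [forall_fin_five, Fin.sum_univ_five, cyclicTable]; omega)
      · by_cases h : 0 ≤ -2 * y 1 + y 2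
        · exact decomposes_of_atoms hA ![0, 1, 0, 2, 0]
            ![0, t - w 1 + 2 * w 3, 0, 3 * w 1 - w 3, 0] (by
        simp [forall_fin_five, Fin.sum_univ_five, cyclicTable]; omega)
        · by_cases h : 0 ≤ y 1 - 2 * y 2 + y 3
          · exact decomposes_of_atoms hA ![0, 0, 1, 4, 0]
              ![0, 0, t - 2 * w 2 + 3 * w 3, 3 * w 2 - 2 * w 3, 0] (by
        simp [forall_fin_five, Fin.sum_univ_five, cyclicTable]; omega)
          · exact decomposes_of_atoms hA ![0, 1, 2, 4, 0]
              ![0, t - w 1 + 2 * w 3, -w 1 + 2 * w 2 - w 3, 2 * w 1 - w 2, 0] (by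
        simp [forall_fin_five, Fin.sum_univ_five, cyclicTable]; omega)

/-- With `y 1` minimal, coordinate 1 can be exhausted by atoms in every cell, which shortens the
subdivision; the other minima follow by symmetry. -/
theorem decomposes_cyclic_five_one_two_three_four {k : Fin 5} {y : Fin 5 → ℤ}
    (hy : ∀ s ∈ ({1, 2, 3, 4} : Finset (Fin 5)), 0 ≤ y s ∧ (5 : ℤ) ∣ y s - cyclicTable 5 k s)
    (hmin : y 1 ≤ y 2 ∧ y 1 ≤ y 3 ∧ y 1 ≤ y 4) : Decomposes 5 (cyclicTable 5) {1, 2, 3, 4} y := by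
  have hA : ∀ k ∈ ({1, 2, 3, 4} : Finset (Fin 5)), IsAtom (cyclicTable 5) {1, 2, 3, 4} k := by decide
  obtain ⟨t, w, h⟩ := exists_cyclic_param hy
  simp only [Finset.forall_mem_insert, Finset.mem_singleton, forall_eq, Fin.isValue] at h
  obtain ⟨⟨p1, e1⟩, ⟨p2, e2⟩, ⟨p3, e3⟩, ⟨p4, e4⟩⟩ := h
  norm_num at e1 e2 e3 e4
  by_cases h : 0 ≤ -2 * y 1 + y 2
  · by_cases h : 0 ≤ -3 * y 1 + 2 * y 4
    · by_cases h : 0 ≤ -y 1 - y 3 + y 4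
      · by_cases h : 0 ≤ -3 * y 1 + y 3
        · exact decomposes_of_atoms hA ![0, 1, 0, 0, 0] ![0, t + 5 * w 1, 0, 0, 0] (by
        simp [forall_fin_five, Fin.sum_univ_five, cyclicTable]; omega)
        · exact decomposes_of_atoms hA ![0, 1, 0, 2, 0]
            ![0, t - w 1 + 2 * w 3, 0, 3 * w 1 - w 3, 0] (by
        simp [forall_fin_five, Fin.sum_univ_five, cyclicTable]; omega)
      · by_cases h : 0 ≤ -4 * y 1 + y 4
        · exact decomposes_of_atoms hA ![0, 1, 0, 0, 0] ![0, t + 5 * w 1, 0, 0, 0] (by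
        simp [forall_fin_five, Fin.sum_univ_five, cyclicTable]; omega)
        · exact decomposes_of_atoms hA ![0, 1, 0, 0, 2]
            ![0, t - 3 * w 1 + 2 * w 4, 0, 0, 4 * w 1 - w 4] (by
        simp [forall_fin_five, Fin.sum_univ_five, cyclicTable]; omega)
    · exact decomposes_of_atoms hA ![0, 2, 0, 0, 3]
        ![0, 2 * t - 2 * w 1 + 3 * w 4, 0, 0, -t + 3 * w 1 - 2 * w 4] (by
        simp [forall_fin_five, Fin.sum_univ_five, cyclicTable]; omega)
  · by_cases h : 0 ≤ y 1 + y 2 - 2 * y 4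
    · exact decomposes_of_atoms hA ![0, 2, 0, 0, 3]
        ![0, 2 * t - 2 * w 1 + 3 * w 4, 0, 0, -t + 3 * w 1 - 2 * w 4] (by
        simp [forall_fin_five, Fin.sum_univ_five, cyclicTable]; omega)
    · by_cases h : 0 ≤ 2 * y 1 - 3 * y 2 + y 4
      · by_cases h : 0 ≤ y 1 - 2 * y 2 + y 3
        · exact decomposes_of_atoms hA ![0, 1, 4, 0, 0]
            ![0, t - 3 * w 1 + 4 * w 2, 2 * w 1 - w 2, 0, 0] (by
        simp [forall_fin_five, Fin.sum_univ_five, cyclicTable]; omega)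
        · exact decomposes_of_atoms hA ![0, 1, 2, 3, 0]
            ![0, t - 3 * w 1 + w 2 + 2 * w 3, w 1 + w 2 - w 3, 2 * w 1 - w 2, 0] (by
        simp [forall_fin_five, Fin.sum_univ_five, cyclicTable]; omega)
      · by_cases h : 0 ≤ y 1 - y 2 - y 3 + y 4
        · exact decomposes_of_atoms hA ![0, 1, 2, 3, 0]
            ![0, t - 3 * w 1 + w 2 + 2 * w 3, w 1 + w 2 - w 3, 2 * w 1 - w 2, 0] (by
        simp [forall_fin_five, Fin.sum_univ_five, cyclicTable]; omega)
        · exact decomposes_of_atoms hA ![0, 1, 2, 0, 3]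
            ![0, t - w 1 - w 2 + 2 * w 4, 2 * w 2 - w 4, 0, 2 * w 1 - w 2] (by
        simp [forall_fin_five, Fin.sum_univ_five, cyclicTable]; omega)

/-! ### Reduction of arbitrary sets of types to the computed ones. -/

/-- Multiplication by a unit modulo `d`. -/
def scale {d : ℕ} [NeZero d] (u v : Fin d) (h : u * v = 1) : Fin d ≃ Fin d where
  toFun s := u * s
  invFun s := v * s
  left_inv s := by
    dsimp only
    rw [← Fin.mul_assoc, Fin.mul_comm v, h, Fin.one_mul]
  right_inv s := by
    dsimp only
    rw [← Fin.mul_assoc, h, Fin.one_mul]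

/-- A unit acting on characters and its inverse acting on elements cancel in the pairing. -/
theorem cyclicTable_scale {d : ℕ} [NeZero d] {u v : Fin d} (h : u * v = 1) (k s : Fin d) :
    cyclicTable d ((scale u v h).symm k) (scale u v h s) = cyclicTable d k s := by
  have : (v * k) * (u * s) = k * s := by
    rw [Fin.mul_comm v, Fin.mul_assoc, ← Fin.mul_assoc v, Fin.mul_comm v, h, Fin.one_mul]
  simpa [cyclicTable, scale, Fin.val_mul] using congrArg (fun x : Fin d => ((x.val : ℕ) : ℤ)) this

theorem Covers.scale {d : ℕ} [NeZero d] {c : ℤ} {S : Finset (Fin d)}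
    (h : Covers c (cyclicTable d) S) {u v : Fin d} (huv : u * v = 1) :
    Covers c (cyclicTable d) (S.map (scale u v huv).toEmbedding) :=
  h.map _ _ (cyclicTable_scale huv)

/-- Coordinates of type zero can be added at will. -/
theorem covers_of_forall_notMem {K T : Type*} [Fintype T] [DecidableEq T] {d : ℤ} {b : K → T → ℤ}
    {s₀ : T} (h₀ : ∀ k, b k s₀ = 0) (h : ∀ S : Finset T, s₀ ∉ S → Covers d b S) (S : Finset T) :
    Covers d b S := by
  by_cases hs : s₀ ∈ S
  · rw [← Finset.insert_erase hs]
    exact (h _ (Finset.notMem_erase _ _)).insert_coord h₀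
  · exact h S hs

theorem covers_cyclic_five_full : Covers 5 (cyclicTable 5) {1, 2, 3, 4} := by
  intro k y hy
  have key : ∀ u v : Fin 5, ∀ huv : u * v = 1,
      ({1, 2, 3, 4} : Finset (Fin 5)).map (scale u v huv).toEmbedding = {1, 2, 3, 4} := by decide
  -- Units mod 5 act transitively on the nonzero coordinates; scaling by `u` brings a minimum at `u`
  -- to position 1.
  have step : ∀ u v : Fin 5, ∀ huv : u * v = 1,
      (y (u * 1) ≤ y (u * 2) ∧ y (u * 1) ≤ y (u * 3) ∧ y (u * 1) ≤ y (u * 4)) →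
      Decomposes 5 (cyclicTable 5) {1, 2, 3, 4} y := by
    intro u v huv hmin
    rw [← key u v huv]
    refine Decomposes.map _ _ (cyclicTable_scale huv) <|
      decomposes_cyclic_five_one_two_three_four (k := scale u v huv k) (fun s hs => ?_) hmin
    have := hy (scale u v huv s) (by rw [← key u v huv]; simpa using hs)
    rw [← cyclicTable_scale huv, Equiv.symm_apply_apply]
    exact this
  have h₁ := step 1 1 rfl
  have h₂ := step 2 3 rfl
  have h₃ := step 3 2 rfl
  have h₄ := step 4 4 rfl
  simp only [Fin.isValue, Fin.reduceMul] at h₁ h₂ h₃ h₄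
  by_contra hcon
  simp only [hcon, imp_false] at h₁ h₂ h₃ h₄
  omega

theorem covers_cyclic_one (S : Finset (Fin 1)) : Covers 1 (cyclicTable 1) S :=
  covers_of_forall_notMem (s₀ := 0) (by decide) (fun S hS => by
    obtain rfl : S = ∅ := by revert S; decide
    exact covers_empty _ _) S

theorem covers_cyclic_two (S : Finset (Fin 2)) : Covers 2 (cyclicTable 2) S := by
  refine covers_of_forall_notMem (s₀ := 0) (by decide) (fun S hS => ?_) S
  have : S = ∅ ∨ S = {1} := by revert S; decide
  rcases this with rfl | rfl
  exacts [covers_empty _ _, covers_cyclic_two_one]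

theorem covers_cyclic_three (S : Finset (Fin 3)) : Covers 3 (cyclicTable 3) S := by
  refine covers_of_forall_notMem (s₀ := 0) (by decide) (fun S hS => ?_) S
  have : S = ∅ ∨ (∃ u v : Fin 3, ∃ h : u * v = 1, S = ({1} : Finset _).map
    (scale u v h).toEmbedding) ∨ S = {1, 2} := by revert S; decide
  rcases this with rfl | ⟨u, v, h, rfl⟩ | rfl
  exacts [covers_empty _ _, covers_cyclic_three_one.scale h, covers_cyclic_three_one_two]

theorem covers_cyclic_four (S : Finset (Fin 4)) : Covers 4 (cyclicTable 4) S := by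
  refine covers_of_forall_notMem (s₀ := 0) (by decide) (fun S hS => ?_) S
  -- Orbit representatives, under the units mod 4, of the sets of nonzero types.
  have : S = ∅ ∨ S = {2} ∨ (∃ u v : Fin 4, ∃ h : u * v = 1,
      S = ({1} : Finset _).map (scale u v h).toEmbedding ∨
      S = ({1, 2} : Finset _).map (scale u v h).toEmbedding) ∨ S = {1, 3} ∨ S = {1, 2, 3} := by
    revert S; decide
  rcases this with rfl | rfl | ⟨u, v, h, rfl | rfl⟩ | rfl | rfl
  exacts [covers_empty _ _, covers_cyclic_four_two, covers_cyclic_four_one.scale h,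
    covers_cyclic_four_one_two.scale h, covers_cyclic_four_one_three,
    covers_cyclic_four_one_two_three]

theorem covers_cyclic_five (S : Finset (Fin 5)) : Covers 5 (cyclicTable 5) S := by
  refine covers_of_forall_notMem (s₀ := 0) (by decide) (fun S hS => ?_) S
  have : S = ∅ ∨ (∃ u v : Fin 5, ∃ h : u * v = 1,
      S = ({1} : Finset _).map (scale u v h).toEmbedding ∨
      S = ({1, 2} : Finset _).map (scale u v h).toEmbedding ∨
      S = ({1, 4} : Finset _).map (scale u v h).toEmbedding ∨
      S = ({1, 2, 3} : Finset _).map (scale u v h).toEmbedding) ∨ S = {1, 2, 3, 4} := by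
    revert S; decide
  rcases this with rfl | ⟨u, v, h, rfl | rfl | rfl | rfl⟩ | rfl
  exacts [covers_empty _ _, covers_cyclic_five_one.scale h, covers_cyclic_five_one_two.scale h,
    covers_cyclic_five_one_four.scale h, covers_cyclic_five_one_two_three.scale h,
    covers_cyclic_five_full]

/-! ### The Klein four-group. -/

/-- The pairing of the Klein four-group with its characters: nonzero elements and nonzero
characters are labelled so that `k` is in the kernel of the character `k`. -/
def kleinTable (k s : Fin 4) : ℤ := if k = 0 ∨ s = 0 ∨ k = s then 0 else 1

theorem covers_klein_one : Covers 2 kleinTable {1} := by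
  intro k y h
  have hA : ∀ k ∈ ({2} : Finset (Fin 4)), IsAtom kleinTable {1} k := by decide
  have h := h 1 (by simp)
  exact decomposes_of_atoms hA ![0, 2, 0, 0] ![0, y 1, 0, 0] (by
    simp [forall_fin_four, Fin.sum_univ_four, kleinTable]; omega)

theorem covers_klein_one_two : Covers 2 kleinTable {1, 2} := by
  intro k y h
  have hA : ∀ k ∈ ({1, 2} : Finset (Fin 4)), IsAtom kleinTable {1, 2} k := by decide
  have h1 := h 1 (by simp)
  have h2 := h 2 (by simp)
  exact decomposes_of_atoms hA ![0, 2, 1, 0] ![0, y 1, y 2, 0] (by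
    simp [forall_fin_four, Fin.sum_univ_four, kleinTable]; omega)

theorem covers_klein_one_two_three : Covers 2 kleinTable {1, 2, 3} := by
  intro k y h
  have hA : ∀ k ∈ ({1, 2, 3} : Finset (Fin 4)), IsAtom kleinTable {1, 2, 3} k := by decide
  -- The three nontrivial characters have trivial product, so `y 1 + y 2 + y 3` is even.
  have hk : 2 ∣ kleinTable k 1 + kleinTable k 2 + kleinTable k 3 := by clear h; revert k; decide
  obtain ⟨p1, h1⟩ := h 1 (by simp)
  obtain ⟨p2, h2⟩ := h 2 (by simp)
  obtain ⟨p3, h3⟩ := h 3 (by simp)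
  obtain ⟨w, hw⟩ : (2 : ℤ) ∣ y 1 + y 2 + y 3 := by omega
  clear h hk h1 h2 h3
  -- The atoms are `(0, 1, 1)`, `(1, 0, 1)`, `(1, 1, 0)`. If the triangle inequalities hold, their
  -- multiplicities are `w - y i`; otherwise two atoms exhaust the two small coordinates and an even
  -- excess remains on the third.
  by_cases q1 : y 2 + y 3 ≤ y 1
  · exact decomposes_of_atoms hA ![0, 0, 3, 2] ![0, 0, y 2, y 3] (by
      simp [forall_fin_four, Fin.sum_univ_four, kleinTable]; omega)
  by_cases q2 : y 1 + y 3 ≤ y 2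
  · exact decomposes_of_atoms hA ![0, 3, 0, 1] ![0, y 1, 0, y 3] (by
      simp [forall_fin_four, Fin.sum_univ_four, kleinTable]; omega)
  by_cases q3 : y 1 + y 2 ≤ y 3
  · exact decomposes_of_atoms hA ![0, 2, 1, 0] ![0, y 1, y 2, 0] (by
      simp [forall_fin_four, Fin.sum_univ_four, kleinTable]; omega)
  · exact decomposes_of_atoms hA ![0, 1, 2, 3] ![0, w - y 1, w - y 2, w - y 3] (by
      simp [forall_fin_four, Fin.sum_univ_four, kleinTable]; omega)

/-- Permuting the nonzero elements and nonzero characters alike preserves the table, so only the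
size of `S \ {0}` matters. -/
theorem covers_klein (S : Finset (Fin 4)) : Covers 2 kleinTable S := by
  refine covers_of_forall_notMem (s₀ := 0) (by decide) (fun S hS => ?_) S
  have hswap : ∀ i j : Fin 4, i ≠ 0 → j ≠ 0 → ∀ k s,
      kleinTable (Equiv.swap i j k) (Equiv.swap i j s) = kleinTable k s := by decide
  have : S = ∅ ∨ (∃ i j : Fin 4, i ≠ 0 ∧ j ≠ 0 ∧
      (S = ({1} : Finset _).map (Equiv.swap i j).toEmbedding ∨
      S = ({1, 2} : Finset _).map (Equiv.swap i j).toEmbedding)) ∨ S = {1, 2, 3} := by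
    revert S; decide
  rcases this with rfl | ⟨i, j, hi, hj, rfl | rfl⟩ | rfl
  exacts [covers_empty _ _, covers_klein_one.map _ _ (hswap i j hi hj),
    covers_klein_one_two.map _ _ (hswap i j hi hj), covers_klein_one_two_three]

/-! ### Coordinates in a simplicial cone and lifting of table decompositions. -/

section Cone

variable {n : ℕ} {r : Fin n → Fin n → ℤ}

theorem eq_of_sum_smul_eq (hdet : (Matrix.of fun i j : Fin n => r j i).det ≠ 0)
    {y y' : Fin n → ℤ} (h : ∑ j, y j • r j = ∑ j, y' j • r j) : y = y' := by
  refine sub_eq_zero.1 (Matrix.eq_zero_of_mulVec_eq_zero hdet ?_)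
  ext i
  have := congrFun h i
  simp only [Finset.sum_apply, Pi.smul_apply, smul_eq_mul] at this
  simpa [Matrix.mulVec, dotProduct, mul_sub, mul_comm, sub_eq_zero] using this

theorem mem_intPoints_pos_iff {z : Fin n → ℤ} : z ∈ intPoints (pos r) ↔
    ∃ c : Fin n → ℝ, (∀ j, 0 ≤ c j) ∧ ∀ i, (z i : ℝ) = ∑ j, c j * r j i := by
  change _ ∈ Submodule.span _ _ ↔ _
  rw [Submodule.mem_span_range_iff_exists_fun]
  constructor
  · rintro ⟨c, hc⟩
    refine ⟨fun j => c j, fun j => (c j).2, fun i => ?_⟩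
    rw [← congrFun hc i]
    simp only [Finset.sum_apply, Pi.smul_apply]
    rfl
  · rintro ⟨c, h₀, hc⟩
    refine ⟨fun j => ⟨c j, h₀ j⟩, ?_⟩
    ext i
    rw [hc i]
    simp [Finset.sum_apply]

theorem mem_intPoints_of_smul_eq {d : ℤ} (hd : 0 < d) {z y : Fin n → ℤ}
    (h : d • z = ∑ j, y j • r j) (hy : ∀ j, 0 ≤ y j) : z ∈ intPoints (pos r) := by
  have hd' : (0 : ℝ) < d := by exact_mod_cast hd
  refine mem_intPoints_pos_iff.2 ⟨fun j => y j / d, fun j => ?_, fun i => ?_⟩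
  · exact div_nonneg (by exact_mod_cast hy j) hd'.le
  · have := congrFun h i
    simp only [Pi.smul_apply, Finset.sum_apply, smul_eq_mul] at this
    have h' : (d : ℝ) * z i = ∑ j, (y j : ℝ) * r j i := by exact_mod_cast this
    rw [eq_comm, ← mul_right_inj' hd'.ne', h', Finset.mul_sum]
    exact Finset.sum_congr rfl fun j _ => by field_simp

/-- Real coordinates with respect to `r` are unique, so `y j` is `d` times a non-negative
coefficient. -/
theorem nonneg_of_mem_intPoints (hdet : (Matrix.of fun i j : Fin n => r j i).det ≠ 0) {d : ℤ}
    (hd : 0 < d) {z y : Fin n → ℤ} (h : d • z = ∑ j, y j • r j) (hz : z ∈ intPoints (pos r))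
    (j : Fin n) : 0 ≤ y j := by
  obtain ⟨c, h₀, hc⟩ := mem_intPoints_pos_iff.1 hz
  have hdet' : ((Matrix.of fun i j : Fin n => r j i).map (Int.cast : ℤ → ℝ)).det ≠ 0 := by
    have := (Int.castRingHom ℝ).map_det (Matrix.of fun i j : Fin n => r j i)
    rw [show ((Matrix.of fun i j : Fin n => r j i).map (Int.cast : ℤ → ℝ)) =
      (Int.castRingHom ℝ).mapMatrix (Matrix.of fun i j : Fin n => r j i) from rfl, ← this]
    simpa using hdet
  have key : (fun j => (d : ℝ) * c j - y j) = 0 := by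
    refine Matrix.eq_zero_of_mulVec_eq_zero hdet' ?_
    ext i
    have := congrFun h i
    simp only [Pi.smul_apply, Finset.sum_apply, smul_eq_mul] at this
    have h' : (d : ℝ) * z i = ∑ j, (y j : ℝ) * r j i := by exact_mod_cast this
    rw [hc i, Finset.mul_sum] at h'
    simp only [Matrix.mulVec, dotProduct, Matrix.map_apply, Matrix.of_apply, mul_sub,
      Finset.sum_sub_distrib, Pi.zero_apply, sub_eq_zero]
    convert h' using 2 <;> ring
  have hj : (y j : ℝ) = d * c j := (sub_eq_zero.1 (congrFun key j)).symm
  have : (0 : ℝ) ≤ y j := hj ▸ mul_nonneg (by exact_mod_cast hd.le) (h₀ j)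
  exact_mod_cast this

theorem self_mem_intPoints (j : Fin n) : r j ∈ intPoints (pos r) :=
  mem_intPoints_of_smul_eq one_pos (y := Pi.single j 1)
    (by simp [Pi.single_apply, ite_smul]) fun i => by
      by_cases h : i = j <;> simp [h]

theorem smul_eq_zero_of_pos {d : ℤ} (hd : 0 < d) {z : Fin n → ℤ} (h : d • z = 0) : z = 0 :=
  (smul_eq_zero.1 h).resolve_left hd.ne'

theorem zero_mem_intPoints (C : PointedCone ℝ (Fin n → ℝ)) : (0 : Fin n → ℤ) ∈ intPoints C := by
  change (fun i => (((0 : Fin n → ℤ) i : ℤ) : ℝ)) ∈ C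
  simp only [Pi.zero_apply, Int.cast_zero]
  exact C.zero_mem

theorem add_mem_intPoints {C : PointedCone ℝ (Fin n → ℝ)} {u v : Fin n → ℤ}
    (hu : u ∈ intPoints C) (hv : v ∈ intPoints C) : u + v ∈ intPoints C := by
  have := C.add_mem hu hv
  change (fun i => (((u + v) i : ℤ) : ℝ)) ∈ C
  convert this using 1
  ext i
  simp

/-- Indecomposable vectors belong to the Hilbert basis. -/
theorem mem_hilbertBasis {C : PointedCone ℝ (Fin n → ℝ)} {h : Fin n → ℤ}
    (hC : h ∈ intPoints C) (h₀ : h ≠ 0)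
    (hirr : ∀ u ∈ intPoints C, ∀ v ∈ intPoints C, u + v = h → u = 0 ∨ v = 0) :
    h ∈ hilbertBasis C := by
  rintro H ⟨hH, hgen⟩
  have hsub : ∀ x ∈ AddSubmonoid.closure H, x ∈ intPoints C := fun x hx =>
    AddSubmonoid.closure_induction (fun x hx => hH hx) (zero_mem_intPoints C)
      (fun _ _ _ _ => add_mem_intPoints) hx
  have key : ∀ x ∈ AddSubmonoid.closure H, x = h → x ∈ H := fun x hx => by
    induction hx using AddSubmonoid.closure_induction with
    | mem x hx => exact fun _ => hx
    | zero => exact fun h' => absurd h'.symm h₀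
    | add x y hx hy ihx ihy =>
      intro h'
      rcases hirr x (hsub x hx) y (hsub y hy) h' with rfl | rfl
      · rw [zero_add] at h' ⊢
        exact ihy h'
      · rw [add_zero] at h' ⊢
        exact ihx h'
  exact key h (hgen h hC) rfl

/-- A system of representatives `γ` of `ℤⁿ` modulo the lattice spanned by `r`, whose coordinates
with respect to `r` are `1 / d` times the entries of the table `b`, up to integers. -/
structure HasTable {K T : Type*} (r : Fin n → Fin n → ℤ) (d : ℤ) (b : K → T → ℤ)
    (σ : Fin n → T) (γ : K → Fin n → ℤ) (α : K → Fin n → ℤ) : Prop where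
  d_pos : 0 < d
  bounds : ∀ k s, 0 ≤ b k s ∧ b k s < d
  smul_eq : ∀ k, d • γ k = ∑ j, α k j • r j
  dvd : ∀ k j, d ∣ α k j - b k (σ j)
  exists_rep : ∀ z : Fin n → ℤ, ∃ (k : K) (w : Fin n → ℤ), z = γ k + ∑ j, w j • r j

section Table

variable {K T : Type*} {d : ℤ} {b : K → T → ℤ} {σ : Fin n → T} {γ α : K → Fin n → ℤ}

theorem HasTable.exists_coords (h : HasTable r d b σ γ α) (z : Fin n → ℤ) :
    ∃ (k : K) (y : Fin n → ℤ), d • z = ∑ j, y j • r j ∧ ∀ j, d ∣ y j - b k (σ j) := by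
  obtain ⟨k, w, rfl⟩ := h.exists_rep z
  refine ⟨k, fun j => α k j + d * w j, ?_, fun j => ?_⟩
  · simp only [smul_add, h.smul_eq, add_smul, Finset.sum_add_distrib, Finset.smul_sum, mul_smul]
  · rw [add_sub_right_comm]
    exact dvd_add (h.dvd k j) (dvd_mul_right _ _)

/-- Removing integral parts of coordinates moves `γ k` into the half-open parallelepiped spanned by
`r`. -/
theorem HasTable.exists_box (h : HasTable r d b σ γ α) (k : K) :
    ∃ z : Fin n → ℤ, d • z = ∑ j, b k (σ j) • r j := by
  choose q hq using h.dvd k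
  refine ⟨γ k - ∑ j, q j • r j, ?_⟩
  rw [smul_sub, h.smul_eq, Finset.smul_sum, ← Finset.sum_sub_distrib]
  refine Finset.sum_congr rfl fun j _ => ?_
  rw [← mul_smul, ← hq, sub_smul, sub_sub_cancel]

/-- Summands of a box vector within the cone have coordinates below `d`, so they are box vectors
themselves, and any splitting is already visible in the table. -/
theorem HasTable.box_mem_hilbertBasis [DecidableEq T] (h : HasTable r d b σ γ α)
    (hdet : (Matrix.of fun i j : Fin n => r j i).det ≠ 0) {k : K}
    (hk : IsAtom b (Finset.univ.image σ) k) {z : Fin n → ℤ}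
    (hz : d • z = ∑ j, b k (σ j) • r j) : z ∈ hilbertBasis (pos r) := by
  simp only [IsAtom, Finset.mem_image, Finset.mem_univ, true_and, exists_exists_eq_and,
    forall_exists_index, forall_apply_eq_imp_iff] at hk
  obtain ⟨⟨j, hj⟩, hk⟩ := hk
  refine mem_hilbertBasis (mem_intPoints_of_smul_eq h.d_pos hz fun j => (h.bounds _ _).1) ?_ ?_
  · rintro rfl
    have := eq_of_sum_smul_eq hdet (y := 0) (by simpa using hz)
    exact hj (congrFun this j).symm
  · rintro u hu v hv rfl
    obtain ⟨k₁, y₁, h₁, hd₁⟩ := h.exists_coords u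
    obtain ⟨k₂, y₂, h₂, hd₂⟩ := h.exists_coords v
    have hp₁ := nonneg_of_mem_intPoints hdet h.d_pos h₁ hu
    have hp₂ := nonneg_of_mem_intPoints hdet h.d_pos h₂ hv
    have hadd : y₁ + y₂ = fun j => b k (σ j) := by
      refine eq_of_sum_smul_eq hdet ?_
      rw [← hz, smul_add, h₁, h₂, ← Finset.sum_add_distrib]
      simp [add_smul]
    have hsum : ∀ j, y₁ j + y₂ j = b k (σ j) := fun j => congrFun hadd j
    have heq : ∀ {k' : K} {y : Fin n → ℤ}, (∀ j, d ∣ y j - b k' (σ j)) → (∀ j, 0 ≤ y j) →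
        (∀ j, y j ≤ b k (σ j)) → ∀ j, y j = b k' (σ j) := by
      intro k' y hd hp hle j
      have h₁ := h.bounds k (σ j)
      have h₂ := h.bounds k' (σ j)
      have h₃ := hle j
      exact sub_eq_zero.1 <| Int.eq_zero_of_abs_lt_dvd (hd j) (abs_lt.2 (by have := hp j; omega))
    have e₁ := heq hd₁ hp₁ fun j => by have := hsum j; have := hp₂ j; omega
    have e₂ := heq hd₂ hp₂ fun j => by have := hsum j; have := hp₁ j; omega
    refine (hk k₁ k₂ fun j => by rw [← e₁, ← e₂, hsum]).imp (fun h' => ?_) (fun h' => ?_)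
    · exact smul_eq_zero_of_pos h.d_pos (by simp [h₁, e₁, h'])
    · exact smul_eq_zero_of_pos h.d_pos (by simp [h₂, e₂, h'])

theorem HasTable.isCombinationOf [Fintype T] [DecidableEq T] (h : HasTable r d b σ γ α)
    (hdet : (Matrix.of fun i j : Fin n => r j i).det ≠ 0)
    (hcov : Covers d b (Finset.univ.image σ)) (hr : ∀ j, r j ∈ hilbertBasis (pos r))
    {z : Fin n → ℤ} (hz : z ∈ intPoints (pos r)) :
    IsCombinationOf (pos r) z n := by
  classical
  obtain ⟨k, y, hy, hdvd⟩ := h.exists_coords z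
  have hy₀ := nonneg_of_mem_intPoints hdet h.d_pos hy hz
  -- `g` will pick, within each type, a coordinate where `y` is least; a decomposition of these
  -- minima fits below `y` everywhere.
  have hmin : ∀ s, s ∈ Finset.univ.image σ → ∃ j, σ j = s ∧ ∀ i, σ i = s → y j ≤ y i := by
    intro s hs
    obtain ⟨i, -, hi⟩ := Finset.mem_image.1 hs
    obtain ⟨j, hj, hle⟩ := Finset.exists_min_image (Finset.univ.filter fun i => σ i = s) y
      ⟨i, by simpa using hi⟩
    exact ⟨j, by simpa using hj, fun i hi => hle i (by simpa using hi)⟩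
  choose g hg hgle using hmin
  have hS : ∀ i, σ i ∈ Finset.univ.image σ := fun i => Finset.mem_image_of_mem _ (Finset.mem_univ i)
  obtain ⟨m, hm⟩ : ∃ m : T → ℤ, ∀ s hs, m s = y (g s hs) :=
    ⟨fun s => if hs : s ∈ Finset.univ.image σ then y (g s hs) else 0, fun s hs => dif_pos hs⟩
  obtain ⟨τ, c, hc⟩ := hcov k m fun s hs => by
    rw [hm s hs]
    exact ⟨hy₀ _, by simpa only [hg] using hdvd (g s hs)⟩
  choose box hbox using h.exists_box
  set q : Fin n → ℤ := fun i => y i - ∑ t, c t * b (τ t) (σ i) with hq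
  -- `P` marks the coordinates whose generator gives way to a box vector: the chosen minimum of each
  -- type with nonzero multiplicity. The remainder `q` vanishes there by `hqP`.
  set P : Fin n → Prop := fun i => g (σ i) (hS i) = i ∧ c (σ i) ≠ 0 with hP
  have hq₀ : ∀ i, 0 ≤ q i := fun i => by
    have h₁ := ((hc (σ i)).2.2 (hS i)).1
    have h₂ := hgle (σ i) (hS i) i rfl
    rw [hm _ (hS i)] at h₁
    exact sub_nonneg.2 (h₁.trans h₂)
  have hqd : ∀ i, d ∣ q i := fun i => by
    have h₁ := ((hc (σ i)).2.2 (hS i)).2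
    have h₂ := hdvd (g (σ i) (hS i))
    have h₃ := dvd_add h₁ (dvd_sub (hdvd i) h₂)
    rw [hm _ (hS i), hg] at h₃
    have h₄ : q i = y (g (σ i) (hS i)) - ∑ t, c t * b (τ t) (σ i) +
        (y i - b k (σ i) - (y (g (σ i) (hS i)) - b k (σ i))) := by
      simp only [q]
      ring
    rwa [h₄]
  have hqP : ∀ i, P i → q i = 0 := fun i hi => by
    have h₁ := ((hc (σ i)).2.1 hi.2).2.2
    rw [hm _ (hS i), hi.1] at h₁
    exact sub_eq_zero.2 h₁.symm
  -- `σ` maps the coordinates in `P` bijectively onto the types with nonzero multiplicity.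
  have hsum : ∀ F : T → Fin n → ℤ, (∀ t, c t = 0 → F t = 0) →
      ∑ i, (if P i then F (σ i) else 0) = ∑ t, F t := by
    intro F hF
    rw [← Finset.sum_filter]
    have : ∑ t, F t = ∑ t ∈ Finset.univ.filter (fun t => c t ≠ 0), F t := by
      refine (Finset.sum_subset (Finset.subset_univ _) fun t _ ht => hF t ?_).symm
      simpa using ht
    rw [this]
    refine Finset.sum_bij (fun i _ => σ i) (fun i hi => ?_) (fun i hi i' hi' he => ?_)
      (fun t ht => ?_) fun _ _ => rfl
    · simpa using (Finset.mem_filter.1 hi).2.2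
    · rw [← (Finset.mem_filter.1 hi).2.1, ← (Finset.mem_filter.1 hi').2.1]
      congr 1
    · have hct : c t ≠ 0 := by simpa using ht
      have htS := ((hc t).2.1 hct).1
      refine ⟨g t htS, Finset.mem_filter.2 ⟨Finset.mem_univ _, ?_, ?_⟩, hg t htS⟩
      · congr 1
        exact hg t htS
      · rwa [hg]
  refine ⟨fun i => if P i then (c (σ i)).toNat else (q i / d).toNat,
    fun i => if P i then box (τ (σ i)) else r i, fun i => ?_, ?_⟩
  · dsimp only
    split_ifs with hi
    · exact h.box_mem_hilbertBasis hdet ((hc _).2.1 hi.2).2.1 (hbox _)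
    · exact hr i
  · have hd0 : d ≠ 0 := h.d_pos.ne'
    refine smul_right_injective _ hd0 ?_
    have hterm : ∀ i, d • ((if P i then (c (σ i)).toNat else (q i / d).toNat) •
        (if P i then box (τ (σ i)) else r i)) =
        (if P i then c (σ i) • ∑ j, b (τ (σ i)) (σ j) • r j else 0) + q i • r i := by
      intro i
      split_ifs with hi
      · rw [hqP i hi, zero_smul, add_zero, ← hbox, smul_comm d, ← natCast_zsmul,
          Int.toNat_of_nonneg (hc _).1]
      · rw [zero_add, ← natCast_zsmul, Int.toNat_of_nonneg (Int.ediv_nonneg (hq₀ i) h.d_pos.le),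
          ← mul_smul, Int.mul_ediv_cancel' (hqd i)]
    change d • z = d • _
    rw [hy, Finset.smul_sum, Finset.sum_congr rfl fun i _ => hterm i, Finset.sum_add_distrib,
      hsum (fun t => c t • ∑ j, b (τ t) (σ j) • r j) fun t ht => by simp [ht]]
    simp only [Finset.smul_sum]
    rw [Finset.sum_comm, ← Finset.sum_add_distrib]
    refine Finset.sum_congr rfl fun j _ => ?_
    simp only [← mul_smul]
    rw [← Finset.sum_smul, ← add_smul]
    simp [hq]

end Table

end Cone

/-! ### The group `ℤⁿ / ⟨r⟩` and its table. -/

section Quotient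

variable {n : ℕ} {r : Fin n → Fin n → ℤ}

theorem linearIndependent_of_det_ne_zero
    (hdet : (Matrix.of fun i j : Fin n => r j i).det ≠ 0) : LinearIndependent ℤ r :=
  Fintype.linearIndependent_iff.2 fun y hy => congrFun <|
    eq_of_sum_smul_eq hdet (y' := 0) (by simpa using hy)

/-- The lattice spanned by `r` has index `|det r|`. -/
theorem card_quotient_span_range (hdet : (Matrix.of fun i j : Fin n => r j i).det ≠ 0) :
    Nat.card ((Fin n → ℤ) ⧸ Submodule.span ℤ (Set.range r)) =
      (Matrix.of fun i j : Fin n => r j i).det.natAbs := by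
  have hli := linearIndependent_of_det_ne_zero hdet
  rw [← Submodule.natAbs_det_basis_change (Pi.basisFun ℤ (Fin n)) _ (Module.Basis.span hli),
    Module.Basis.det_apply]
  congr 2
  ext i j
  simp [Module.Basis.toMatrix_apply, Module.Basis.span_apply]

theorem exists_sum_of_mkQ_eq {u v : Fin n → ℤ}
    (h : (Submodule.span ℤ (Set.range r)).mkQ u = (Submodule.span ℤ (Set.range r)).mkQ v) :
    ∃ w : Fin n → ℤ, u = v + ∑ j, w j • r j := by
  rw [Submodule.mkQ_apply, Submodule.mkQ_apply, Submodule.Quotient.eq,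
    Submodule.mem_span_range_iff_exists_fun] at h
  obtain ⟨w, hw⟩ := h
  exact ⟨w, by rw [hw]; abel⟩

/-- Cones with a cyclic group of box points. -/
theorem exists_hasTable_of_isAddCyclic {d : ℕ} (hd : d ≠ 0)
    (hcard : Nat.card ((Fin n → ℤ) ⧸ Submodule.span ℤ (Set.range r)) = d)
    (hcyc : IsAddCyclic ((Fin n → ℤ) ⧸ Submodule.span ℤ (Set.range r))) :
    ∃ σ γ α, HasTable r (d : ℤ) (cyclicTable d) σ γ α := by
  have : NeZero d := ⟨hd⟩
  have hd' : (0 : ℤ) < d := by positivity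
  set N := Submodule.span ℤ (Set.range r) with hN
  obtain ⟨q, hq⟩ := hcyc.exists_generator
  obtain ⟨g, rfl⟩ := N.mkQ_surjective q
  obtain ⟨a, ha⟩ : ∃ a : Fin n → ℤ, (d : ℤ) • g = 0 + ∑ j, a j • r j := by
    refine exists_sum_of_mkQ_eq ?_
    rw [map_zero, map_zsmul, natCast_zsmul, ← hcard]
    exact card_nsmul_eq_zero'
  rw [zero_add] at ha
  have hlt : ∀ x : ℤ, (x % d).toNat < d := fun x => by
    have := Int.emod_lt_of_pos x hd'
    omega
  have hval : ∀ x : ℤ, (((x % d).toNat : ℕ) : ℤ) = x % d := fun x =>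
    Int.toNat_of_nonneg (Int.emod_nonneg x hd'.ne')
  -- `g` generates the quotient and `d • g` has coordinates `a`, so the type of `j` is the residue
  -- of `a j` and the representatives are the multiples of `g`.
  refine ⟨fun j => ⟨(a j % d).toNat, hlt _⟩, fun k => (k.val : ℤ) • g, fun k j => k.val * a j,
    hd', fun k s => ⟨Int.natCast_nonneg _, ?_⟩, fun k => ?_, fun k j => ?_, fun z => ?_⟩
  · exact Int.ofNat_lt.2 (Nat.mod_lt _ (Nat.pos_of_ne_zero hd))
  · rw [smul_comm, ha, Finset.smul_sum]
    simp only [mul_smul]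
  · rw [cyclicTable, Int.natCast_mod, Nat.cast_mul, hval, Int.mul_emod, Int.emod_emod,
      ← Int.mul_emod]
    exact Int.dvd_self_sub_emod
  · obtain ⟨t, ht⟩ := AddSubgroup.mem_zmultiples_iff.1 (hq (N.mkQ z))
    obtain ⟨w, hw⟩ : ∃ w : Fin n → ℤ, z = t • g + ∑ j, w j • r j :=
      exists_sum_of_mkQ_eq (by rw [map_zsmul, ← hN, ht])
    refine ⟨⟨(t % d).toNat, hlt _⟩, fun j => w j + (t / d) * a j, ?_⟩
    simp only [add_smul, mul_smul, Finset.sum_add_distrib, ← Finset.smul_sum, ← ha, hval]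
    rw [hw]
    have : t • g = (t % d) • g + (t / d) • (d : ℤ) • g := by
      rw [← mul_smul, ← add_smul, mul_comm, Int.emod_add_mul_ediv]
    rw [this]
    abel

/-- Element orders divide 4 but are never 4, so the exponent divides 2; it is not 1 since `G` is
nontrivial. -/
theorem isAddKleinFour_of_not_isAddCyclic {G : Type*} [AddCommGroup G] (hcard : Nat.card G = 4)
    (hcyc : ¬IsAddCyclic G) : IsAddKleinFour G := by
  have hfin : Finite G := Nat.finite_of_card_ne_zero (by omega)
  refine ⟨hcard, ?_⟩
  have h₁ : AddMonoid.exponent G ∣ 2 := by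
    refine AddMonoid.exponent_dvd_of_forall_nsmul_eq_zero fun g => addOrderOf_dvd_iff_nsmul_eq_zero.1 ?_
    have h₂ : addOrderOf g ∣ 4 := hcard ▸ addOrderOf_dvd_natCard g
    have h₃ : addOrderOf g ≠ 4 := fun h => hcyc (isAddCyclic_of_addOrderOf_eq_card g (by rw [h, hcard]))
    have h₄ : addOrderOf g ≤ 4 := Nat.le_of_dvd (by norm_num) h₂
    interval_cases addOrderOf g <;> omega
  rcases (Nat.dvd_prime Nat.prime_two).1 h₁ with h | h
  · have := AddMonoid.exp_eq_one_iff.1 h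
    rw [Nat.card_of_subsingleton 0] at hcard
    omega
  · exact h

/-- Cones with a non-cyclic group of box points of order four. -/
theorem exists_hasTable_of_isAddKleinFour
    (h : IsAddKleinFour ((Fin n → ℤ) ⧸ Submodule.span ℤ (Set.range r))) :
    ∃ σ γ α, HasTable r 2 kleinTable σ γ α := by
  classical
  set N := Submodule.span ℤ (Set.range r) with hN
  have hfin : Finite ((Fin n → ℤ) ⧸ N) := Nat.finite_of_card_ne_zero (by simp)
  let _ := Fintype.ofFinite ((Fin n → ℤ) ⧸ N)
  have hnt : Nontrivial ((Fin n → ℤ) ⧸ N) :=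
    Finite.one_lt_card_iff_nontrivial.1 (by simp)
  obtain ⟨q₁, hq₁⟩ := exists_ne (0 : (Fin n → ℤ) ⧸ N)
  obtain ⟨q₂, hq₂, hne⟩ : ∃ q₂ : (Fin n → ℤ) ⧸ N, q₂ ≠ 0 ∧ q₁ ≠ q₂ := by
    by_contra! hcon
    have : (Finset.univ : Finset ((Fin n → ℤ) ⧸ N)) ⊆ {0, q₁} := fun q _ => by
      by_cases hq : q = 0
      · simp [hq]
      · simp [hcon q hq]
    have := (Finset.card_le_card this).trans Finset.card_le_two
    rw [Finset.card_univ, ← Nat.card_eq_fintype_card, h.card_four] at this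
    omega
  have huniv := IsAddKleinFour.eq_finset_univ hq₁ hq₂ hne
  obtain ⟨g₁, rfl⟩ := N.mkQ_surjective q₁
  obtain ⟨g₂, rfl⟩ := N.mkQ_surjective q₂
  have htwo : ∀ g : Fin n → ℤ, ∃ a : Fin n → ℤ, (2 : ℤ) • g = ∑ j, a j • r j := fun g => by
    obtain ⟨a, ha⟩ : ∃ a : Fin n → ℤ, (2 : ℤ) • g = 0 + ∑ j, a j • r j := by
      refine exists_sum_of_mkQ_eq ?_
      rw [map_zero, map_zsmul, two_smul]
      exact IsAddKleinFour.add_self _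
    exact ⟨a, by rw [ha, zero_add]⟩
  obtain ⟨a₁, ha₁⟩ := htwo g₁
  obtain ⟨a₂, ha₂⟩ := htwo g₂
  -- The parities of `a₁ j` and `a₂ j` determine the character; its label is that of the nonzero
  -- element it kills: 1 for `g₁`, 2 for `g₂`, 3 for `g₁ + g₂`.
  refine ⟨fun j => if 2 ∣ a₁ j then (if 2 ∣ a₂ j then 0 else 1) else if 2 ∣ a₂ j then 2 else 3,
    ![0, g₁, g₂, g₁ + g₂], ![0, a₁, a₂, a₁ + a₂], two_pos, by decide, ?_, ?_, fun z => ?_⟩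
  · rw [forall_fin_four]
    refine ⟨by simp, ha₁, ha₂, ?_⟩
    change (2 : ℤ) • (g₁ + g₂) = ∑ j, (a₁ j + a₂ j) • r j
    rw [smul_add, ha₁, ha₂, ← Finset.sum_add_distrib]
    simp only [add_smul]
  · rw [forall_fin_four]
    refine ⟨fun j => ?_, fun j => ?_, fun j => ?_, fun j => ?_⟩ <;>
    · by_cases h₁ : 2 ∣ a₁ j <;> by_cases h₂ : 2 ∣ a₂ j <;> simp [h₁, h₂, kleinTable] <;> omega
  · have hz := huniv ▸ Finset.mem_univ (N.mkQ z)
    simp only [Finset.mem_insert, Finset.mem_singleton, ← map_add] at hz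
    rcases hz with hz | hz | hz | hz
    · exact ⟨3, exists_sum_of_mkQ_eq hz⟩
    · exact ⟨1, exists_sum_of_mkQ_eq hz⟩
    · exact ⟨2, exists_sum_of_mkQ_eq hz⟩
    · exact ⟨0, exists_sum_of_mkQ_eq (by simpa using hz)⟩

end Quotient

/-! ### Upper bound: `n` elements suffice. -/

section UpperBound

variable {n : ℕ}

theorem isCombinationOf_of_mem_hilbertBasis {r : Fin n → Fin n → ℤ}
    (hdet : (Matrix.of fun i j : Fin n => r j i).det ≠ 0)
    (h5 : |(Matrix.of fun i j : Fin n => r j i).det| ≤ 5)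
    (hr : ∀ j, r j ∈ hilbertBasis (pos r)) {z : Fin n → ℤ} (hz : z ∈ intPoints (pos r)) :
    IsCombinationOf (pos r) z n := by
  have hcard := card_quotient_span_range hdet
  obtain ⟨d, hd⟩ : ∃ d, (Matrix.of fun i j : Fin n => r j i).det.natAbs = d := ⟨_, rfl⟩
  rw [hd] at hcard
  have hd₀ : d ≠ 0 := by omega
  have hd₅ : d ≤ 5 := by
    rw [Int.abs_eq_natAbs] at h5
    omega
  by_cases hcyc : IsAddCyclic ((Fin n → ℤ) ⧸ Submodule.span ℤ (Set.range r))
  · obtain ⟨σ, γ, α, h⟩ := exists_hasTable_of_isAddCyclic hd₀ hcard hcyc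
    refine h.isCombinationOf hdet ?_ hr hz
    clear h
    interval_cases d
    exacts [absurd rfl hd₀, covers_cyclic_one _, covers_cyclic_two _, covers_cyclic_three _,
      covers_cyclic_four _, covers_cyclic_five _]
  · have hd₄ : d = 4 := by
      by_contra hne
      refine hcyc ?_
      rcases eq_or_ne d 1 with rfl | h₁
      · have := (Nat.card_eq_one_iff_unique.1 hcard).1
        infer_instance
      · have : Fact d.Prime := ⟨by interval_cases d <;> first | omega | norm_num⟩
        exact isAddCyclic_of_prime_card hcard
    obtain ⟨σ, γ, α, h⟩ := exists_hasTable_of_isAddKleinFour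
      (isAddKleinFour_of_not_isAddCyclic (hcard.trans hd₄) hcyc)
    exact h.isCombinationOf hdet (covers_klein _) hr hz

/-- Cramer's rule: up to sign, `y` is the adjugate applied to `z`. -/
theorem exists_abs_det_smul_eq (r : Fin n → Fin n → ℤ) (z : Fin n → ℤ) :
    ∃ y : Fin n → ℤ, |(Matrix.of fun i j : Fin n => r j i).det| • z = ∑ j, y j • r j := by
  set M := Matrix.of fun i j : Fin n => r j i with hM
  have key : M.det • z = ∑ j, (M.adjugate.mulVec z) j • r j := by
    have : M.mulVec (M.adjugate.mulVec z) = M.det • z := by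
      rw [Matrix.mulVec_mulVec, Matrix.mul_adjugate, Matrix.smul_mulVec, Matrix.one_mulVec]
    rw [← this]
    ext i
    simp [Matrix.mulVec, dotProduct, hM, mul_comm]
  rcases abs_choice M.det with h | h <;> rw [h]
  · exact ⟨_, key⟩
  · exact ⟨fun j => -(M.adjugate.mulVec z) j, by rw [neg_smul, key]; simp⟩

/-- Every integral point is a combination of `n` elements of the Hilbert basis. -/
theorem isCombinationOf_of_abs_det_le_five (r : Fin n → Fin n → ℤ)
    (hdet : (Matrix.of fun i j : Fin n => r j i).det ≠ 0)
    (h5 : |(Matrix.of fun i j : Fin n => r j i).det| ≤ 5) {z : Fin n → ℤ}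
    (hz : z ∈ intPoints (pos r)) : IsCombinationOf (pos r) z n := by
  induction hD : (Matrix.of fun i j : Fin n => r j i).det.natAbs using Nat.strong_induction_on
    generalizing r with
  | _ D ih =>
  by_cases hr : ∀ j, r j ∈ hilbertBasis (pos r)
  · exact isCombinationOf_of_mem_hilbertBasis hdet h5 hr hz
  push Not at hr
  obtain ⟨j₀, hj₀⟩ := hr
  have hpos : 0 < |(Matrix.of fun i j : Fin n => r j i).det| := abs_pos.2 hdet
  set δ := |(Matrix.of fun i j : Fin n => r j i).det| with hδ
  have hr₀ : r j₀ ≠ 0 := fun h => hdet <| Matrix.det_eq_zero_of_column_eq_zero j₀ fun i => by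
    simp [h]
  have hred : ∃ u ∈ intPoints (pos r), ∃ v ∈ intPoints (pos r), u + v = r j₀ ∧ u ≠ 0 ∧ v ≠ 0 := by
    by_contra! hcon
    refine hj₀ (mem_hilbertBasis (self_mem_intPoints j₀) hr₀ fun u hu v hv h => ?_)
    by_cases hu₀ : u = 0
    · exact Or.inl hu₀
    · exact Or.inr (hcon u hu v hv h hu₀)
  obtain ⟨u, hu, v, hv, huv, hu₀, hv₀⟩ := hred
  obtain ⟨a, ha⟩ := exists_abs_det_smul_eq r u
  obtain ⟨b, hb⟩ := exists_abs_det_smul_eq r v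
  rw [← hδ] at ha hb
  have ha₀ := nonneg_of_mem_intPoints hdet hpos ha hu
  have hb₀ := nonneg_of_mem_intPoints hdet hpos hb hv
  -- Non-negative coordinates summing to a multiple of a unit vector vanish off `j₀`, so `u` and `v`
  -- lie on the ray of `r j₀`.
  have hab : a + b = Pi.single j₀ δ := by
    refine eq_of_sum_smul_eq hdet ?_
    simp only [Pi.add_apply, add_smul, Finset.sum_add_distrib]
    rw [← ha, ← hb, ← smul_add, huv]
    simp [Pi.single_apply, ite_smul]
  have hsingle : ∀ {x x' : Fin n → ℤ}, x + x' = Pi.single j₀ δ → (∀ j, 0 ≤ x j) →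
      (∀ j, 0 ≤ x' j) → ∑ j, x j • r j = x j₀ • r j₀ := by
    intro x x' hx h₀ h₀'
    refine Finset.sum_eq_single j₀ (fun j _ hj => ?_) (by simp)
    have := congrFun hx j
    rw [Pi.add_apply, Pi.single_eq_of_ne hj] at this
    rw [show x j = 0 by linarith [h₀ j, h₀' j], zero_smul]
  rw [hsingle hab ha₀ hb₀] at ha
  rw [hsingle (by rwa [add_comm]) hb₀ ha₀] at hb
  have hab₀ : a j₀ + b j₀ = δ := by simpa using congrFun hab j₀
  have ha₁ : 0 < a j₀ := (ha₀ j₀).lt_of_ne' fun h => hu₀ <|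
    smul_eq_zero_of_pos hpos (by rw [ha, h, zero_smul])
  have hb₁ : 0 < b j₀ := (hb₀ j₀).lt_of_ne' fun h => hv₀ <|
    smul_eq_zero_of_pos hpos (by rw [hb, h, zero_smul])
  have hupd : (Matrix.of fun i j : Fin n => Function.update r j₀ u j i) =
      (Matrix.of fun i j : Fin n => r j i).updateCol j₀ u := by
    ext i j
    by_cases h : j = j₀
    · subst h; simp
    · simp [h]
  -- Scaling one column by `a j₀ / δ` makes the new `|det|` equal to `a j₀`, which lies strictly
  -- between 0 and `δ`.
  have hdet' : δ * (Matrix.of fun i j : Fin n => Function.update r j₀ u j i).det =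
      a j₀ * (Matrix.of fun i j : Fin n => r j i).det := by
    rw [hupd, ← Matrix.det_updateCol_smul, ha, Matrix.det_updateCol_smul]
    congr 2
    ext i j
    by_cases h : j = j₀
    · subst h; simp
    · simp [h]
  have habs := congrArg abs hdet'
  rw [abs_mul, abs_mul, abs_of_pos ha₁, abs_of_pos hpos, ← hδ, mul_comm, mul_left_inj' hpos.ne']
    at habs
  have hcone : pos (Function.update r j₀ u) = pos r := by
    have hle : ∀ (r r' : Fin n → Fin n → ℤ) (c : Fin n → ℝ), (∀ j, 0 ≤ c j) →
        (∀ j i, (r j i : ℝ) = c j * r' j i) → pos r ≤ pos r' := by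
      intro r r' c hc h
      refine Submodule.span_le.2 ?_
      rintro _ ⟨j, rfl⟩
      have : (fun i => (r j i : ℝ)) = (⟨c j, hc j⟩ : {x : ℝ // 0 ≤ x}) • fun i => (r' j i : ℝ) := by
        ext i
        exact h j i
      change (fun i => (r j i : ℝ)) ∈ Submodule.span _ _
      rw [this]
      exact Submodule.smul_mem _ _ (Submodule.subset_span ⟨j, rfl⟩)
    have hau : ∀ i, (δ : ℝ) * u i = a j₀ * r j₀ i := fun i => by
      exact_mod_cast congrFun ha i
    have hδ' : (0 : ℝ) < δ := by exact_mod_cast hpos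
    have ha' : (0 : ℝ) < a j₀ := by exact_mod_cast ha₁
    refine le_antisymm (hle _ _ (Function.update 1 j₀ (a j₀ / δ)) (fun j => ?_) fun j i => ?_)
      (hle _ _ (Function.update 1 j₀ (δ / a j₀)) (fun j => ?_) fun j i => ?_)
    · by_cases h : j = j₀
      · subst h; simp; positivity
      · simp [h]
    · by_cases h : j = j₀
      · subst h
        simp only [Function.update_self]
        field_simp
        linarith [hau i]
      · simp [h]
    · by_cases h : j = j₀
      · subst h; simp; positivity
      · simp [h]
    · by_cases h : j = j₀
      · subst h
        simp only [Function.update_self]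
        field_simp
        linarith [hau i]
      · simp [h]
  rw [← hcone] at hz ⊢
  refine ih _ ?_ _ ?_ ?_ hz rfl
  · rw [← hD, ← Int.ofNat_lt, ← Int.abs_eq_natAbs, ← Int.abs_eq_natAbs, habs]
    omega
  · rw [← abs_pos, habs]
    exact ha₁
  · omega

end UpperBound

/-! ### Lower bound: fewer than `n` elements do not suffice. -/

section LowerBound

variable {n : ℕ} {r : Fin n → Fin n → ℤ}

/-- The Hilbert basis is contained in the set of integral points of the parallelepiped spanned by
the generators, so it is finite. -/
theorem hilbertBasis_finite (hdet : (Matrix.of fun i j : Fin n => r j i).det ≠ 0) :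
    (hilbertBasis (pos r)).Finite := by
  have hδ : 0 < |(Matrix.of fun i j : Fin n => r j i).det| := abs_pos.2 hdet
  choose coords hcoords using exists_abs_det_smul_eq r
  set δ := |(Matrix.of fun i j : Fin n => r j i).det|
  have hinj : Function.Injective coords := fun u v huv => by
    have : δ • u = δ • v := by rw [hcoords, hcoords, huv]
    exact smul_right_injective _ hδ.ne' this
  let F : Set (Fin n → ℤ) := {z | ∀ j, coords z j ∈ Set.Icc 0 δ}
  have hF : F.Finite := by
    refine ((Set.Finite.pi' fun _ : Fin n => Set.finite_Icc (0 : ℤ) δ).preimage hinj.injOn).subset ?_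
    exact fun z hz => hz
  -- The Hilbert basis lies in every generating set, and `F` generates: splitting off integral parts
  -- of coordinates leaves a point of `F`.
  refine hF.subset (Set.sInter_subset_of_mem ⟨fun z hz => ?_, fun z hz => ?_⟩)
  · exact mem_intPoints_of_smul_eq hδ (hcoords z) fun j => (hz j).1
  · have hz₀ := nonneg_of_mem_intPoints hdet hδ (hcoords z) hz
    have hr : ∀ j, r j ∈ F := fun j => by
      have : coords (r j) = Pi.single j δ := by
        refine eq_of_sum_smul_eq hdet ?_
        rw [← hcoords]
        simp [Pi.single_apply, ite_smul]
      intro i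
      rw [this]
      by_cases h : i = j
      · subst h; simp [hδ.le]
      · simp [h, hδ.le]
    have hsplit : δ • (z - ∑ j, (coords z j / δ) • r j) = ∑ j, (coords z j % δ) • r j := by
      rw [smul_sub, hcoords, Finset.smul_sum, ← Finset.sum_sub_distrib]
      refine Finset.sum_congr rfl fun j _ => ?_
      rw [← mul_smul, ← sub_smul, Int.emod_def]
    have hrest : z - ∑ j, (coords z j / δ) • r j ∈ F := by
      have : coords (z - ∑ j, (coords z j / δ) • r j) = fun j => coords z j % δ :=
        eq_of_sum_smul_eq hdet (by rw [← hcoords, hsplit])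
      intro j
      rw [this]
      exact ⟨Int.emod_nonneg _ hδ.ne', (Int.emod_lt_of_pos _ hδ).le⟩
    rw [← sub_add_cancel z (∑ j, (coords z j / δ) • r j)]
    refine add_mem (AddSubmonoid.subset_closure hrest) (sum_mem fun j _ => ?_)
    have : (coords z j / δ) • r j = (coords z j / δ).toNat • r j := by
      rw [← natCast_zsmul, Int.toNat_of_nonneg (Int.ediv_nonneg (hz₀ j) hδ.le)]
    rw [this]
    exact nsmul_mem (AddSubmonoid.subset_closure (hr j)) _

/-- Points on the moment curve with respect to `r` are in general position. -/
theorem linearIndependent_moment (hdet : (Matrix.of fun i j : Fin n => r j i).det ≠ 0)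
    {N : Fin n → ℕ} (hN : Function.Injective N) :
    LinearIndependent ℚ fun k i => ((∑ j : Fin n, (N k ^ j.val) • r j) i : ℚ) := by
  -- The points are the rows of a Vandermonde matrix times the matrix with rows `r j`.
  have hM : IsUnit (Matrix.vandermonde (fun k => (N k : ℚ)) *
      ((Matrix.of fun i j : Fin n => r j i).map (Int.cast : ℤ → ℚ)).transpose) := by
    rw [Matrix.isUnit_iff_isUnit_det, Matrix.det_mul, Matrix.det_transpose, isUnit_iff_ne_zero]
    refine mul_ne_zero (Matrix.det_vandermonde_ne_zero_iff.2 fun a b h => hN ?_) ?_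
    · exact_mod_cast h
    · have := (Int.castRingHom ℚ).map_det (Matrix.of fun i j : Fin n => r j i)
      change ((Int.castRingHom ℚ).mapMatrix (Matrix.of fun i j : Fin n => r j i)).det ≠ 0
      rw [← this]
      simpa using hdet
  convert Matrix.linearIndependent_rows_of_isUnit hM using 1
  ext k i
  simp [Matrix.mul_apply, Matrix.vandermonde_apply]

/-- Some integral point of the cone is not a combination of fewer than `n` elements of the Hilbert
basis. -/
theorem exists_forall_not_isCombinationOf
    (hdet : (Matrix.of fun i j : Fin n => r j i).det ≠ 0) :
    ∃ z ∈ intPoints (pos r), ∀ k < n, ¬IsCombinationOf (pos r) z k := by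
  classical
  by_contra! hcon
  have hv : ∀ N : ℕ, (∑ j : Fin n, (N ^ j.val) • r j) ∈ intPoints (pos r) := fun N =>
    mem_intPoints_of_smul_eq one_pos (y := fun j => ((N ^ j.val : ℕ) : ℤ))
      (by simp only [one_smul, natCast_zsmul]) fun j => Int.natCast_nonneg _
  choose k hk c h hmem hsum using fun N => hcon _ (hv N)
  let B : Set (Fin n → ℤ) := hilbertBasis (pos r)
  have hB : Finite B := (hilbertBasis_finite hdet).to_subtype
  -- `f N` is the set of basis elements used for the `N`-th point. It takes finitely many values, so
  -- some set `A` serves infinitely many `N`.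
  let f : ℕ → Set B := fun N => Set.range fun i => ⟨h N i, hmem N i⟩
  obtain ⟨A, hA⟩ := Finite.exists_infinite_fiber f
  let e : ℕ ↪ f ⁻¹' {A} := Infinite.natEmbedding _
  let W : Submodule ℚ (Fin n → ℚ) := Submodule.span ℚ ((fun b : B => fun i => (b.1 i : ℚ)) '' A)
  have hinW : ∀ N : f ⁻¹' {A},
      (fun i => ((∑ j : Fin n, (N.1 ^ j.val) • r j) i : ℚ)) ∈ W := by
    rintro ⟨N, rfl⟩
    have : (fun i => ((∑ j : Fin n, (N ^ j.val) • r j) i : ℚ)) =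
        ∑ l, (c N l : ℚ) • fun i => (h N l i : ℚ) := by
      ext i
      rw [hsum N]
      simp
    rw [this]
    exact sum_mem fun l _ => Submodule.smul_mem _ _ <|
      Submodule.subset_span ⟨⟨h N l, hmem N l⟩, ⟨l, rfl⟩, rfl⟩
  have hfin : Module.finrank ℚ W < n := by
    obtain ⟨N, hN⟩ := e 0
    have hcard : A.ncard ≤ k N := by
      rw [← Set.mem_singleton_iff.1 hN]
      change (Set.range _).ncard ≤ k N
      rw [← Set.image_univ]
      exact (Set.ncard_image_le Set.finite_univ).trans (by simp)
    let _ := (A.toFinite.image fun b : B => fun i => (b.1 i : ℚ)).fintype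
    calc Module.finrank ℚ W ≤ ((fun b : B => fun i => (b.1 i : ℚ)) '' A).ncard := by
          rw [Set.ncard_eq_toFinset_card']
          exact finrank_span_le_card _
      _ ≤ A.ncard := Set.ncard_image_le A.toFinite
      _ ≤ k N := hcard
      _ < n := hk N
  have hli := linearIndependent_moment hdet (N := fun i : Fin n => (e i.val).1) fun a b hab =>
    Fin.ext (e.injective (Subtype.ext hab))
  have hli' : LinearIndependent ℚ fun i : Fin n => (⟨_, hinW (e i.val)⟩ : W) :=
    LinearIndependent.of_comp W.subtype hli
  have := hli'.fintype_card_le_finrank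
  rw [Fintype.card_fin] at this
  omega

end LowerBound

end IntCarath

theorem theorem1 (n : ℕ) (r : Fin n → (Fin n → ℤ))
    (h1 : 1 ≤ |(Matrix.of fun i j : Fin n => r j i).det|)
    (h5 : |(Matrix.of fun i j : Fin n => r j i).det| ≤ 5) :
    IntCarath.icr (IntCarath.pos r) = (n : ℕ∞) := by
  have hdet : (Matrix.of fun i j : Fin n => r j i).det ≠ 0 :=
    abs_pos.1 (lt_of_lt_of_le one_pos h1)
  refine le_antisymm (iSup₂_le fun z hz => ?_) ?_
  · exact iInf₂_le n (IntCarath.isCombinationOf_of_abs_det_le_five r hdet h5 hz)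
  · obtain ⟨z, hz, hk⟩ := IntCarath.exists_forall_not_isCombinationOf hdet
    refine le_iSup₂_of_le z hz (le_iInf₂ fun k hzk => ?_)
    exact Nat.cast_le.2 (not_lt.1 fun hlt => hk k hlt hzk)
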